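/- Let $A=(a_{ij})\in\mathbb{Z}^{n\times n}$ be a simply-laced generalized Cartan matrix, i.e. $a_{ii}=2$, $a_{ij}\in\{0,-1\}$ for $i\neq j$, and $a_{ij}=0\Leftrightarrow a_{ji}=0$. Let $\mathfrak h$ be a real vector space with elements $h_1,\dots,h_n\in\mathfrak h$ and $\alpha_1,\dots,\alpha_n\in\mathfrak h^*$ such that $\alpha_j(h_i)=a_{ij}$, and let $\mathfrak g$ be the real Lie algebra generated by $\mathfrak h$ (embedded linearly) and $e_1,\dots,e_n,f_1,\dots,f_n$ with relations $$[h,h']=0,\quad [h,e_j]=\alpha_j(h)e_j,\quad [h,f_j]=-\alpha_j(h)f_j,\quad [e_i,f_j]=\delta_{ij}h_i,\quad \mathrm{ad}(e_i)^{1-a_{ij}}(e_j)=0=\mathrm{ad}(f_i)^{1-a_{ij}}(f_j)\ (i\ne j).$$ (If $\mathfrak h$ is a realization of $A$ in the sense of Kac, this is the split-real Kac–Moody algebra $\mathfrak g(A)$; if $\mathfrak h=\mathbb R^n$ with basis $h_1,\dots,h_n$, it is the Lie algebra on the $3n$ Chevalley generators, which is the derived algebra $\mathfrak g'(A)$ and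 equals $\mathfrak g(A)$ when $A$ is invertible.) For signs $\rho=(\rho_1,\dots,\rho_n)\in\{\pm1\}^n$ let $\sigma=\sigma_\rho=\eta\tau$, where $\eta$ and $\tau$ are the automorphisms of $\mathfrak g$ with $\eta(e_i)=f_i$, $\eta(f_i)=e_i$, $\eta(h)=-h$ and $\tau(e_i)=\rho_ie_i$, $\tau(f_i)=\rho_i^{-1}f_i$, $\tau(h)=h$ for $h\in\mathfrak h$. Let $\mathrm{Fix}_\sigma(\mathfrak g)$ be the subalgebra of elements fixed by $\sigma$, with Berman generators $Z_i=e_i+\rho_if_i$. For $\rho_1=\dots=\rho_n=-1$ the map $\sigma$ is the Chevalley involution $\omega$, and the Berman generators of $\mathrm{Fix}_\omega(\mathfrak g)$ are $X_i=e_i-f_i$. Call a homomorphism of real Lie algebras $\phi:\mathrm{Fix}_\sigma(\mathfrak g)\to \mathbb C^{N\times N}$ (with the commutator bracket) *of spin type* if for all $i,j$ $$\phi(Z_i)^2=\frac{\rho_i}{4}\,\mathrm{Id},\qquad \phi(Z_i)\phi(Z_j)-\phi(Z_j)\phi(Z_i)=0\ \text{ if } a_{ij}=0,\qquad \phi(Z_i)\phi(Z_j)+\phi(Z_j)\phi(Z_i)=0\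 \text{ if } a_{ij}=-1 .$$ For $\rho_1=\dots=\rho_n=-1$ these are the spin-$\tfrac12$ representations of $\mathrm{Fix}_\omega(\mathfrak g)$. Then for every choice of signs $\rho$: 1. There exist $N\ge 1$ and a representation $\phi:\mathrm{Fix}_\sigma(\mathfrak g)\to\mathbb C^{N\times N}$ of spin type. 2. Every spin-$\tfrac12$ representation $\phi_0:\mathrm{Fix}_\omega(\mathfrak g)\to\mathbb C^{N\times N}$ gives such a representation: there is a representation $\phi:\mathrm{Fix}_\sigma(\mathfrak g)\to\mathbb C^{N\times N}$ of spin type with $\phi(Z_i)=\phi_0(X_i)$ if $\rho_i=-1$ and $\phi(Z_i)=\sqrt{-1}\,\phi_0(X_i)$ if $\rho_i=+1$. -/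

import Mathlib

attribute [local instance 100] LieRing.ofAssociativeRing

noncomputable section

/-- Generalized Cartan matrices. Such a matrix is simply-laced if it also satisfies Mathlib's
`Matrix.IsSimplyLaced`: all its off-diagonal entries are `0` or `-1`. -/
structure IsGCM {n : ℕ} (A : Matrix (Fin n) (Fin n) ℤ) : Prop where
  diag : ∀ i, A i i = 2
  nonpos : ∀ i j, i ≠ j → A i j ≤ 0
  zero_iff : ∀ i j, A i j = 0 ↔ A j i = 0

/-- A real vector space `𝔥` with simple coroots `h_i ∈ 𝔥` and simple roots `α_i ∈ 𝔥*` such that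
`α_j (h_i) = a_ij`. Neither independence of the (co)roots nor a value of `dim 𝔥` is required, so
this covers at once Kac's realizations of `A` (independent roots, independent coroots,
`dim 𝔥 = 2 n - rank A`), whose Lie algebra is the Kac-Moody algebra `𝔤(A)`, and the datum
`CartanDatum.derived` below, whose Lie algebra is the one on the `3 n` Chevalley generators
`e_i, f_i, h_i`, that is the derived algebra `𝔤'(A)`, equal to `𝔤(A)` for invertible `A`. -/
structure CartanDatum {n : ℕ} (A : Matrix (Fin n) (Fin n) ℤ) (𝔥 : Type*)
    [AddCommGroup 𝔥] [Module ℝ 𝔥] where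
  coroot : Fin n → 𝔥
  root : Fin n → Module.Dual ℝ 𝔥
  root_coroot : ∀ i j, root j (coroot i) = A i j

/-- The datum in which the simple coroots are a basis of `𝔥`. -/
def CartanDatum.derived {n : ℕ} (A : Matrix (Fin n) (Fin n) ℤ) : CartanDatum A (Fin n → ℝ) where
  coroot i := Pi.single i 1
  root j := ∑ i, (A i j : ℝ) • LinearMap.proj i
  root_coroot i j := by
    simp [LinearMap.sum_apply, Pi.single_apply]

namespace KacMoody

/-- Generators: `e_i`, `f_i`, and the elements of `𝔥`. -/
inductive Gen (n : ℕ) (𝔥 : Type*)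
  | e : Fin n → Gen n 𝔥
  | f : Fin n → Gen n 𝔥
  | h : 𝔥 → Gen n 𝔥

section

variable {n : ℕ} {A : Matrix (Fin n) (Fin n) ℤ} {𝔥 : Type*} [AddCommGroup 𝔥] [Module ℝ 𝔥]

variable (n 𝔥) in
/-- The free Lie algebra on the generators. -/
abbrev Free : Type _ := FreeLieAlgebra ℝ (Gen n 𝔥)

/-- The free generator `e_i`. -/
abbrev gE (𝔥 : Type*) (i : Fin n) : Free n 𝔥 := FreeLieAlgebra.of ℝ (Gen.e i)

/-- The free generator `f_i`. -/
abbrev gF (𝔥 : Type*) (i : Fin n) : Free n 𝔥 := FreeLieAlgebra.of ℝ (Gen.f i)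

/-- The free generator given by an element of `𝔥`. -/
abbrev gH (n : ℕ) (x : 𝔥) : Free n 𝔥 := FreeLieAlgebra.of ℝ (Gen.h x)

/-- The elements of the free Lie algebra that are set to zero: `𝔥` is embedded linearly and is
abelian, and the Chevalley-Serre relations hold. -/
inductive IsRelator (D : CartanDatum A 𝔥) : Free n 𝔥 → Prop
  | h_add (x y : 𝔥) : IsRelator D (gH n (x + y) - (gH n x + gH n y))
  | h_smul (c : ℝ) (x : 𝔥) : IsRelator D (gH n (c • x) - c • gH n x)
  | h_h (x y : 𝔥) : IsRelator D ⁅gH n x, gH n y⁆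
  | h_e (x : 𝔥) (j : Fin n) : IsRelator D (⁅gH n x, gE 𝔥 j⁆ - D.root j x • gE 𝔥 j)
  | h_f (x : 𝔥) (j : Fin n) : IsRelator D (⁅gH n x, gF 𝔥 j⁆ + D.root j x • gF 𝔥 j)
  | e_f (i : Fin n) : IsRelator D (⁅gE 𝔥 i, gF 𝔥 i⁆ - gH n (D.coroot i))
  | e_f_ne (i j : Fin n) (hij : i ≠ j) : IsRelator D ⁅gE 𝔥 i, gF 𝔥 j⁆
  | serre_e (i j : Fin n) (hij : i ≠ j) : IsRelator D
      ((LieAlgebra.ad ℝ (Free n 𝔥) (gE 𝔥 i) ^ (1 - A i j).toNat) (gE 𝔥 j))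
  | serre_f (i j : Fin n) (hij : i ≠ j) : IsRelator D
      ((LieAlgebra.ad ℝ (Free n 𝔥) (gF 𝔥 i) ^ (1 - A i j).toNat) (gF 𝔥 j))

/-- The ideal generated by the relators. -/
def relIdeal (D : CartanDatum A 𝔥) : LieIdeal ℝ (Free n 𝔥) :=
  LieSubmodule.lieSpan ℝ _ {x | IsRelator D x}

/-- The split-real Kac-Moody algebra of the datum `D`. -/
def Alg (D : CartanDatum A 𝔥) : Type _ := Free n 𝔥 ⧸ relIdeal D

instance (D : CartanDatum A 𝔥) : LieRing (Alg D) :=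
  inferInstanceAs (LieRing (Free n 𝔥 ⧸ relIdeal D))

instance (D : CartanDatum A 𝔥) : LieAlgebra ℝ (Alg D) :=
  inferInstanceAs (LieAlgebra ℝ (Free n 𝔥 ⧸ relIdeal D))

variable (D : CartanDatum A 𝔥)

/-- The quotient map. -/
def mk : Free n 𝔥 →ₗ⁅ℝ⁆ Alg D where
  toFun x := LieSubmodule.Quotient.mk (N := relIdeal D) x
  map_add' _ _ := rfl
  map_smul' _ _ := rfl
  map_lie' := rfl

/-- The Chevalley generator `e_i`. -/
def e (i : Fin n) : Alg D := mk D (gE 𝔥 i)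

/-- The Chevalley generator `f_i`. -/
def f (i : Fin n) : Alg D := mk D (gF 𝔥 i)

/-- The image of an element of `𝔥`. -/
def h (x : 𝔥) : Alg D := mk D (gH n x)

variable {D}

theorem mk_relator {x : Free n 𝔥} (hx : IsRelator D x) : mk D x = 0 :=
  (LieSubmodule.Quotient.mk_eq_zero' (N := relIdeal D)).2 (LieSubmodule.subset_lieSpan hx)

/-- The homomorphism out of `Alg D` given by images of the generators that satisfy the
relations. -/
def lift {L : Type*} [LieRing L] [LieAlgebra ℝ L] (g : Gen n 𝔥 → L)
    (hg : ∀ x, IsRelator D x → FreeLieAlgebra.lift ℝ g x = 0) : Alg D →ₗ⁅ℝ⁆ L :=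
  have hle : relIdeal D ≤ (FreeLieAlgebra.lift ℝ g).ker :=
    LieSubmodule.lieSpan_le.2 fun x hx => (LieHom.mem_ker).2 (hg x hx)
  { Submodule.liftQ (relIdeal D).toSubmodule
      (FreeLieAlgebra.lift ℝ g : Free n 𝔥 →ₗ[ℝ] L)
      (fun x hx => (LieHom.mem_ker).1 (hle hx)) with
    map_lie' := by
      rintro ⟨x⟩ ⟨y⟩
      exact LieHom.map_lie (FreeLieAlgebra.lift ℝ g) x y }

theorem lift_mk {L : Type*} [LieRing L] [LieAlgebra ℝ L] (g : Gen n 𝔥 → L)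
    (hg : ∀ x, IsRelator D x → FreeLieAlgebra.lift ℝ g x = 0)
    (x : Free n 𝔥) : lift g hg (mk D x) = FreeLieAlgebra.lift ℝ g x := rfl

theorem h_add (x y : 𝔥) : h D (x + y) = h D x + h D y := by
  have := mk_relator (IsRelator.h_add (D := D) x y)
  rwa [map_sub, map_add, sub_eq_zero] at this

theorem h_smul (c : ℝ) (x : 𝔥) : h D (c • x) = c • h D x := by
  have := mk_relator (IsRelator.h_smul (D := D) c x)
  rwa [map_sub, map_smul, sub_eq_zero] at this

theorem lie_h_h (x y : 𝔥) : ⁅h D x, h D y⁆ = 0 := by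
  have := mk_relator (IsRelator.h_h (D := D) x y)
  rwa [LieHom.map_lie] at this

theorem lie_h_e (x : 𝔥) (j : Fin n) : ⁅h D x, e D j⁆ = D.root j x • e D j := by
  have := mk_relator (IsRelator.h_e (D := D) x j)
  rwa [map_sub, map_smul, LieHom.map_lie, sub_eq_zero] at this

theorem lie_h_f (x : 𝔥) (j : Fin n) : ⁅h D x, f D j⁆ = -(D.root j x • f D j) := by
  have := mk_relator (IsRelator.h_f (D := D) x j)
  rwa [map_add, map_smul, LieHom.map_lie, add_eq_zero_iff_eq_neg] at this

theorem lie_e_f (i : Fin n) : ⁅e D i, f D i⁆ = h D (D.coroot i) := by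
  have := mk_relator (IsRelator.e_f (D := D) i)
  rwa [map_sub, LieHom.map_lie, sub_eq_zero] at this

theorem lie_e_f_ne {i j : Fin n} (hij : i ≠ j) : ⁅e D i, f D j⁆ = 0 := by
  have := mk_relator (IsRelator.e_f_ne (D := D) i j hij)
  rwa [LieHom.map_lie] at this

theorem map_ad_pow {L L' : Type*} [LieRing L] [LieAlgebra ℝ L] [LieRing L'] [LieAlgebra ℝ L']
    (g : L →ₗ⁅ℝ⁆ L') (x y : L) (k : ℕ) :
    g ((LieAlgebra.ad ℝ L x ^ k) y) = (LieAlgebra.ad ℝ L' (g x) ^ k) (g y) := by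
  induction k with
  | zero => simp
  | succ k ih => simp only [pow_succ', Module.End.mul_apply, LieAlgebra.ad_apply,
      LieHom.map_lie, ih]

theorem ad_smul_pow {L : Type*} [LieRing L] [LieAlgebra ℝ L] (a b : ℝ) (x y : L) (k : ℕ) :
    (LieAlgebra.ad ℝ L (a • x) ^ k) (b • y) = (a ^ k * b) • (LieAlgebra.ad ℝ L x ^ k) y := by
  rw [map_smul, map_smul, smul_pow, LinearMap.smul_apply, smul_smul, mul_comm]

theorem serre_e {i j : Fin n} (hij : i ≠ j) :
    (LieAlgebra.ad ℝ (Alg D) (e D i) ^ (1 - A i j).toNat) (e D j) = 0 := by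
  have := mk_relator (IsRelator.serre_e (D := D) i j hij)
  rwa [map_ad_pow] at this

theorem serre_f {i j : Fin n} (hij : i ≠ j) :
    (LieAlgebra.ad ℝ (Alg D) (f D i) ^ (1 - A i j).toNat) (f D j) = 0 := by
  have := mk_relator (IsRelator.serre_f (D := D) i j hij)
  rwa [map_ad_pow] at this

variable (D)

/-- Images of the generators under `η`. -/
def etaGen : Gen n 𝔥 → Alg D
  | Gen.e i => f D i
  | Gen.f i => e D i
  | Gen.h x => -h D x

/-- The automorphism `η : e_i ↦ f_i, f_i ↦ e_i, h ↦ -h`. -/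
def eta : Alg D →ₗ⁅ℝ⁆ Alg D :=
  lift (etaGen D) (by
    intro x hx
    cases hx with
    | h_add x y => simp [etaGen, h_add]; abel
    | h_smul c x => simp [etaGen, h_smul]
    | h_h x y => simp [etaGen, lie_h_h]
    | h_e x j => simp [etaGen, lie_h_f]
    | h_f x j => simp [etaGen, lie_h_e]
    | e_f i =>
      simp only [map_sub, LieHom.map_lie, FreeLieAlgebra.lift_of_apply, etaGen]
      rw [← lie_skew, lie_e_f, sub_self]
    | e_f_ne i j hij =>
      simp only [LieHom.map_lie, FreeLieAlgebra.lift_of_apply, etaGen]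
      rw [← lie_skew, lie_e_f_ne hij.symm, neg_zero]
    | serre_e i j hij =>
      rw [map_ad_pow]
      simpa only [FreeLieAlgebra.lift_of_apply, etaGen] using serre_f hij
    | serre_f i j hij =>
      rw [map_ad_pow]
      simpa only [FreeLieAlgebra.lift_of_apply, etaGen] using serre_e hij)

/-- The sign `ρ_i ∈ {1, -1}` as a real number. -/
abbrev sgn (ρ : Fin n → ℤˣ) (i : Fin n) : ℝ := ((ρ i : ℤ) : ℝ)

theorem sgn_mul_inv (ρ : Fin n → ℤˣ) (i : Fin n) : sgn ρ i * (sgn ρ i)⁻¹ = 1 :=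
  mul_inv_cancel₀ (by simp [sgn])

/-- Images of the generators under `τ`. -/
def tauGen (ρ : Fin n → ℤˣ) : Gen n 𝔥 → Alg D
  | Gen.e i => sgn ρ i • e D i
  | Gen.f i => (sgn ρ i)⁻¹ • f D i
  | Gen.h x => h D x

/-- The automorphism `τ : e_i ↦ ρ_i e_i, f_i ↦ ρ_i⁻¹ f_i, h ↦ h`. -/
def tau (ρ : Fin n → ℤˣ) : Alg D →ₗ⁅ℝ⁆ Alg D :=
  lift (tauGen D ρ) (by
    intro x hx
    cases hx with
    | h_add x y => simp [tauGen, h_add]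
    | h_smul c x => simp [tauGen, h_smul]
    | h_h x y => simp [tauGen, lie_h_h]
    | h_e x j =>
      simp only [map_sub, map_smul, LieHom.map_lie, FreeLieAlgebra.lift_of_apply, tauGen]
      rw [lie_smul, lie_h_e, smul_comm, sub_self]
    | h_f x j =>
      simp only [map_add, map_smul, LieHom.map_lie, FreeLieAlgebra.lift_of_apply, tauGen]
      rw [lie_smul, lie_h_f, smul_neg, smul_comm, neg_add_cancel]
    | e_f i =>
      simp only [map_sub, LieHom.map_lie, FreeLieAlgebra.lift_of_apply, tauGen]
      rw [smul_lie, lie_smul, smul_smul, sgn_mul_inv, one_smul, lie_e_f, sub_self]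
    | e_f_ne i j hij =>
      simp only [LieHom.map_lie, FreeLieAlgebra.lift_of_apply, tauGen]
      rw [smul_lie, lie_smul, lie_e_f_ne hij, smul_zero, smul_zero]
    | serre_e i j hij =>
      rw [map_ad_pow]
      simp only [FreeLieAlgebra.lift_of_apply, tauGen]
      rw [ad_smul_pow, serre_e hij, smul_zero]
    | serre_f i j hij =>
      rw [map_ad_pow]
      simp only [FreeLieAlgebra.lift_of_apply, tauGen]
      rw [ad_smul_pow, serre_f hij, smul_zero])

/-- The involution `σ = η τ`. For `ρ_i = -1` for all `i` it is the Chevalley involution `ω`. -/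
def sigma (ρ : Fin n → ℤˣ) : Alg D →ₗ⁅ℝ⁆ Alg D := (eta D).comp (tau D ρ)

/-- The involutory subalgebra `Fix_σ` of elements fixed by `σ = η τ`. -/
def fixSub (ρ : Fin n → ℤˣ) : LieSubalgebra ℝ (Alg D) where
  carrier := {x | sigma D ρ x = x}
  add_mem' {x y} hx hy := by simp_all
  zero_mem' := by simp
  smul_mem' c x hx := by simp_all
  lie_mem' {x y} hx hy := by simp_all

theorem sigma_e (ρ : Fin n → ℤˣ) (i : Fin n) : sigma D ρ (e D i) = sgn ρ i • f D i := by
  change eta D (tau D ρ (e D i)) = _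
  have h1 : tau D ρ (e D i) = sgn ρ i • e D i := by simp [tau, e, lift_mk, tauGen]
  have h2 : eta D (e D i) = f D i := by simp [eta, e, lift_mk, etaGen]
  rw [h1, map_smul, h2]

theorem sigma_f (ρ : Fin n → ℤˣ) (i : Fin n) : sigma D ρ (f D i) = (sgn ρ i)⁻¹ • e D i := by
  change eta D (tau D ρ (f D i)) = _
  have h1 : tau D ρ (f D i) = (sgn ρ i)⁻¹ • f D i := by simp [tau, f, lift_mk, tauGen]
  have h2 : eta D (f D i) = e D i := by simp [eta, f, lift_mk, etaGen]
  rw [h1, map_smul, h2]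

/-- The Berman generator `Z_i = e_i + ρ_i f_i` of `Fix_σ`; it is called `X_i` if `ρ_i = -1` and
`Y_i` if `ρ_i = 1`. -/
def berman (ρ : Fin n → ℤˣ) (i : Fin n) : fixSub D ρ :=
  ⟨e D i + sgn ρ i • f D i, by
    change sigma D ρ (e D i + sgn ρ i • f D i) = _
    rw [map_add, map_smul, sigma_e, sigma_f, smul_smul, sgn_mul_inv, one_smul, add_comm]⟩

end

end KacMoody

/-- The relations between the representation matrices of the Berman generators. For `ρ_i = -1`
for all `i` these are the relations that characterize spin-`1/2` representations. -/
structure SpinRelations {n N : ℕ} (A : Matrix (Fin n) (Fin n) ℤ) (ρ : Fin n → ℤˣ)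
    (M : Fin n → Matrix (Fin N) (Fin N) ℂ) : Prop where
  sq : ∀ i, M i ^ 2 = (((ρ i : ℤ) : ℂ) / 4) • (1 : Matrix (Fin N) (Fin N) ℂ)
  comm : ∀ i j, A i j = 0 → M i * M j - M j * M i = 0
  anticomm : ∀ i j, A i j = -1 → M i * M j + M j * M i = 0

end

/-! The point is that Fix_σ satisfies Berman's presentation: elements `M i` of an associative
algebra R with [M_i,M_j] = 0 for a_ij = 0 and [M_i,[M_i,M_j]] = ρ_i M_j for a_ij = -1 are the images
of the Z_i under a homomorphism (`exists_hom_of_berman_relations`). Spin matrices satisfy these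
relations, because x² = c/4 and xy = -yx give [x,[x,y]] = 4x²y = cy. It then remains to exhibit
matrices: signed bit flips for the first claim, the φ₀(X_i) multiplied by 1 or √-1 for the second.

To build the homomorphism without a structure theory of 𝔤, let V be the Verma module of highest
weight 0 over the algebra without Serre relations. As f_i = ρ_i(Z_i - e_i) and e_i shortens words,
there is a linear map `bermanEval` : V → R sending the highest weight vector to 1 and Z_i x to M_i
times the value of x. Let K be the largest subspace of its kernel stable under all e_i and 𝔥. By
maximality K is also stable under the f_i and contains the images of the negative Serre elements;
the positive ones already act as zero on V. So 𝔤 acts on V/K and the evaluation descends to ev.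

The x in 𝔤 for which ev(x y) = m · ev(y) with some m form a subalgebra containing the Z_i. These
generate Fix_σ (`fixSub_le`), so x ↦ ev(x v), with v the highest weight vector, is the homomorphism.
-/

noncomputable section

namespace KacMoody

attribute [local instance 2000] LieRing.toBracket

/-! ### Serre elements and Berman generators under the Chevalley relations -/

section Chevalley

variable {n : ℕ} {A : Matrix (Fin n) (Fin n) ℤ} {𝔥 : Type*} [AddCommGroup 𝔥] [Module ℝ 𝔥]
  {L : Type*} [LieRing L] [LieAlgebra ℝ L]

/-- The defining relations of `Alg D` other than the Serre relations and the linearity of the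
embedding of `𝔥`. -/
structure ChevalleyRelations (D : CartanDatum A 𝔥) (E F : Fin n → L) (H : 𝔥 → L) : Prop where
  h_h : ∀ x y, ⁅H x, H y⁆ = 0
  h_e : ∀ x j, ⁅H x, E j⁆ = D.root j x • E j
  h_f : ∀ x j, ⁅H x, F j⁆ = -(D.root j x • F j)
  e_f : ∀ i, ⁅E i, F i⁆ = H (D.coroot i)
  e_f_ne : ∀ i j, i ≠ j → ⁅E i, F j⁆ = 0

/-- The left-hand side of the Serre relation for a family of elements. -/
def serre (A : Matrix (Fin n) (Fin n) ℤ) (X : Fin n → L) (i j : Fin n) : L :=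
  (LieAlgebra.ad ℝ L (X i) ^ (1 - A i j).toNat) (X j)

theorem serre_of_eq_zero (X : Fin n → L) {i j : Fin n} (h : A i j = 0) :
    serre A X i j = ⁅X i, X j⁆ := by
  simp [serre, h]

theorem serre_of_eq_neg_one (X : Fin n → L) {i j : Fin n} (h : A i j = -1) :
    serre A X i j = ⁅X i, ⁅X i, X j⁆⁆ := by
  have : (1 - A i j).toNat = 2 := by rw [h]; rfl
  simp [serre, this, pow_two]

theorem lie_lie_sub_smul {h e f : L} {a b : ℝ} (hf : ⁅h, f⁆ = -(b • f)) :
    ⁅⁅h, e⁆ - a • e, f⁆ = ⁅h, ⁅e, f⁆⁆ + (b - a) • ⁅e, f⁆ := by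
  rw [sub_lie, lie_lie, hf, lie_neg, lie_smul, smul_lie]
  module

namespace ChevalleyRelations

variable {D : CartanDatum A 𝔥} {E F : Fin n → L} {H : 𝔥 → L}

theorem symm (h : ChevalleyRelations D E F H) : ChevalleyRelations D F E (fun x => -H x) where
  h_h x y := by simp [h.h_h]
  h_e x j := by simp [h.h_f]
  h_f x j := by simp [h.h_e]
  e_f i := by rw [← lie_skew, h.e_f]
  e_f_ne i j hij := by rw [← lie_skew, h.e_f_ne j i hij.symm, neg_zero]

theorem f_e (h : ChevalleyRelations D E F H) (i : Fin n) : ⁅F i, E i⁆ = -H (D.coroot i) :=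
  h.symm.e_f i

theorem f_e_ne (h : ChevalleyRelations D E F H) {i j : Fin n} (hij : i ≠ j) : ⁅F i, E j⁆ = 0 :=
  h.symm.e_f_ne i j hij

theorem coroot_e (h : ChevalleyRelations D E F H) (i j : Fin n) :
    ⁅H (D.coroot i), E j⁆ = (A i j : ℝ) • E j := by
  rw [h.h_e, D.root_coroot]

theorem coroot_f (h : ChevalleyRelations D E F H) (i j : Fin n) :
    ⁅H (D.coroot i), F j⁆ = -((A i j : ℝ) • F j) := by
  rw [h.h_f, D.root_coroot]

theorem e_coroot (h : ChevalleyRelations D E F H) (i j : Fin n) :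
    ⁅E j, H (D.coroot i)⁆ = -((A i j : ℝ) • E j) := by
  rw [← lie_skew, h.coroot_e]

/-- The Serre elements on the positive side commute with the negative generators. -/
theorem f_serre (h : ChevalleyRelations D E F H) (hA : IsGCM A) (hsl : A.IsSimplyLaced)
    {i j : Fin n} (hij : i ≠ j) (k : Fin n) : ⁅F k, serre A E i j⁆ = 0 := by
  rcases hsl hij with h0 | h1
  · rw [serre_of_eq_zero E h0, leibniz_lie]
    have h0' := (hA.zero_iff i j).1 h0
    rcases eq_or_ne k i with rfl | hki
    · rw [h.f_e, h.f_e_ne hij, neg_lie, h.coroot_e, h0]; simp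
    · rw [h.f_e_ne hki]
      rcases eq_or_ne k j with rfl | hkj
      · rw [h.f_e, lie_neg, h.e_coroot, h0']; simp
      · rw [h.f_e_ne hkj]; simp
  · rw [serre_of_eq_neg_one E h1, leibniz_lie, leibniz_lie (F k)]
    rcases eq_or_ne k i with rfl | hki
    -- The coefficient of [e_i,e_j] is -(2 + a_ij) - a_ij, which is zero for a_ij = -1.
    · rw [h.f_e, h.f_e_ne hij, neg_lie, neg_lie, leibniz_lie, h.coroot_e, h.coroot_e, h1,
        hA.diag]
      simp only [lie_zero, add_zero, smul_lie, lie_smul, lie_neg]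
      push_cast
      module
    · rw [h.f_e_ne hki]
      rcases eq_or_ne k j with rfl | hkj
      -- The inner bracket is a multiple of e_i, so the outer one vanishes.
      · rw [h.f_e, lie_neg, h.e_coroot]; simp
      · rw [h.f_e_ne hkj]; simp

theorem e_serre (h : ChevalleyRelations D E F H) (hA : IsGCM A) (hsl : A.IsSimplyLaced)
    {i j : Fin n} (hij : i ≠ j) (k : Fin n) : ⁅E k, serre A F i j⁆ = 0 :=
  h.symm.f_serre hA hsl hij k

/-- The Serre elements on the negative side are weight vectors. -/
theorem exists_h_serre (h : ChevalleyRelations D E F H) (i j : Fin n) (x : 𝔥) :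
    ∃ c : ℝ, ⁅H x, serre A F i j⁆ = c • serre A F i j := by
  unfold serre
  induction (1 - A i j).toNat with
  | zero => exact ⟨-D.root j x, by simp [h.h_f]⟩
  | succ k ih =>
    obtain ⟨c, hc⟩ := ih
    refine ⟨c - D.root i x, ?_⟩
    rw [pow_succ', Module.End.mul_apply, LieAlgebra.ad_apply, leibniz_lie, hc, h.h_f, neg_lie,
      smul_lie, lie_smul]
    module

theorem lie_berman_of_eq_zero (h : ChevalleyRelations D E F H) (r : Fin n → ℝ) {i j : Fin n}
    (hij : i ≠ j) (h0 : A i j = 0) :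
    ⁅E i + r i • F i, E j + r j • F j⁆ = serre A E i j + (r i * r j) • serre A F i j := by
  rw [serre_of_eq_zero E h0, serre_of_eq_zero F h0]
  simp only [add_lie, lie_add, smul_lie, lie_smul, h.f_e_ne hij, h.e_f_ne i j hij]
  module

/-- The mixed terms [f_i,[e_i,e_j]] = e_j and [e_i,[f_i,f_j]] = f_j add up to the multiple of the
Berman generator. Hence, where the positive Serre element vanishes, the defect in the Berman
relation is a multiple of the negative one. -/
theorem lie_lie_berman_of_eq_neg_one (h : ChevalleyRelations D E F H) (r : Fin n → ℝ)
    {i j : Fin n} (hij : i ≠ j) (h1 : A i j = -1) :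
    ⁅E i + r i • F i, ⁅E i + r i • F i, E j + r j • F j⁆⁆ =
      serre A E i j + (r i * r i * r j) • serre A F i j + r i • (E j + r j • F j) := by
  have h2 : ⁅F i, ⁅E i, E j⁆⁆ = E j := by
    rw [leibniz_lie, h.f_e, h.f_e_ne hij, neg_lie, h.coroot_e, h1]; simp
  have h3 : ⁅E i, ⁅F i, F j⁆⁆ = F j := by
    rw [leibniz_lie, h.e_f, h.e_f_ne i j hij, h.coroot_f, h1]; simp
  rw [serre_of_eq_neg_one E h1, serre_of_eq_neg_one F h1]
  simp only [add_lie, lie_add, smul_lie, lie_smul, h.f_e_ne hij, h.e_f_ne i j hij, h2, h3,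
    lie_zero, smul_zero]
  module

end ChevalleyRelations

end Chevalley

/-! ### The Verma module without Serre relations -/

section Verma

variable {n : ℕ} {A : Matrix (Fin n) (Fin n) ℤ} {𝔥 : Type*} [AddCommGroup 𝔥] [Module ℝ 𝔥]

/-- The space underlying the Verma module of highest weight `0` over the Lie algebra without
Serre relations: its basis consists of the words in the negative generators. -/
abbrev Verma (n : ℕ) : Type := List (Fin n) →₀ ℝ

/-- The basis vector of a word. -/
abbrev word (w : List (Fin n)) : Verma n := Finsupp.single w 1

variable (D : CartanDatum A 𝔥)

/-- The sum of the roots of the letters of a word. -/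
def wordRoot (w : List (Fin n)) : Module.Dual ℝ 𝔥 := (w.map D.root).sum

/-- The action of `f_i`: prepend the letter `i`. -/
def vermaF (i : Fin n) : Module.End ℝ (Verma n) :=
  Finsupp.linearCombination ℝ fun w => word (i :: w)

/-- The action of `𝔥`. -/
def vermaH (x : 𝔥) : Module.End ℝ (Verma n) :=
  Finsupp.linearCombination ℝ fun w => -wordRoot D w x • word w

/-- The action of `e_i`: a linear combination of the words with one letter `i` removed. -/
def vermaE (i : Fin n) : Module.End ℝ (Verma n) :=
  Finsupp.linearCombination ℝ fun w => ∑ k : Fin w.length,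
    -- Commuting e_i past the removed f_i leaves h_i, which acts on the remaining letters to its
    -- right by this scalar.
    if w[k] = i then -wordRoot D (w.drop (k + 1)) (D.coroot i) • word (w.eraseIdx k) else 0

theorem vermaF_word (i : Fin n) (w : List (Fin n)) : vermaF i (word w) = word (i :: w) := by
  simp [vermaF]

theorem vermaH_word (x : 𝔥) (w : List (Fin n)) :
    vermaH D x (word w) = -wordRoot D w x • word w := by
  rw [vermaH, Finsupp.linearCombination_single, one_smul]

theorem vermaE_nil (i : Fin n) : vermaE D i (word []) = 0 := by
  simp [vermaE]

theorem vermaE_cons (i j : Fin n) (w : List (Fin n)) :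
    vermaE D i (word (j :: w)) = vermaF j (vermaE D i (word w)) +
      if i = j then vermaH D (D.coroot i) (word w) else 0 := by
  simp only [vermaE, Finsupp.linearCombination_single, one_smul]
  rw [add_comm, map_sum]
  refine (Fin.sum_univ_succ (n := w.length) _).trans ?_
  congr 1
  · simp only [vermaH_word, eq_comm (a := i)]
    rfl
  · refine Finset.sum_congr rfl fun k _ => ?_
    rw [apply_ite (vermaF j), map_zero, map_smul, vermaF_word]
    rfl

theorem verma_ext {V : Type*} [AddCommGroup V] [Module ℝ V] {f g : Verma n →ₗ[ℝ] V}
    (h : ∀ w, f (word w) = g (word w)) : f = g :=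
  Finsupp.lhom_ext' fun w => LinearMap.ext_ring (h w)

theorem vermaE_mul_vermaF (i j : Fin n) : vermaE D i * vermaF j =
    vermaF j * vermaE D i + if i = j then vermaH D (D.coroot i) else 0 := by
  refine verma_ext fun w => ?_
  rw [Module.End.mul_apply, vermaF_word, vermaE_cons]
  split_ifs <;> simp

theorem end_lie_apply {V : Type*} [AddCommGroup V] [Module ℝ V] (X Y : Module.End ℝ V) (v : V) :
    ⁅X, Y⁆ v = X (Y v) - Y (X v) := rfl

/-- An operator that commutes with all `f_i` and kills the highest weight vector is zero. -/
theorem verma_eq_zero {X : Module.End ℝ (Verma n)} (h0 : X (word []) = 0)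
    (h : ∀ i, ⁅X, (vermaF i : Module.End ℝ (Verma n))⁆ = 0) : X = 0 := by
  refine verma_ext fun w => ?_
  induction w with
  | nil => simpa using h0
  | cons i w ih =>
    have := LinearMap.congr_fun (h i) (word w)
    rw [LieRing.of_associative_ring_bracket, LinearMap.sub_apply, Module.End.mul_apply,
      Module.End.mul_apply, vermaF_word, ih, LinearMap.zero_apply, map_zero, sub_zero] at this
    simpa using this

theorem vermaH_add (x y : 𝔥) : vermaH D (x + y) = vermaH D x + vermaH D y := by
  refine verma_ext fun w => ?_
  rw [LinearMap.add_apply, vermaH_word, vermaH_word, vermaH_word, map_add]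
  module

theorem vermaH_smul (c : ℝ) (x : 𝔥) : vermaH D (c • x) = c • vermaH D x := by
  refine verma_ext fun w => ?_
  rw [LinearMap.smul_apply, vermaH_word, vermaH_word, map_smul, smul_eq_mul]
  module

theorem vermaH_nil (x : 𝔥) : vermaH D x (word []) = 0 := by
  rw [vermaH_word]; simp [wordRoot]

theorem lie_vermaH_vermaH (x y : 𝔥) : ⁅vermaH D x, vermaH D y⁆ = 0 := by
  refine verma_ext fun w => ?_
  simp only [LieRing.of_associative_ring_bracket, LinearMap.sub_apply, Module.End.mul_apply,
    vermaH_word, map_smul, LinearMap.zero_apply]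
  module

theorem lie_vermaH_vermaF (x : 𝔥) (j : Fin n) :
    ⁅vermaH D x, vermaF j⁆ = -(D.root j x • vermaF j) := by
  refine verma_ext fun w => ?_
  simp only [LieRing.of_associative_ring_bracket, LinearMap.sub_apply, Module.End.mul_apply,
    vermaH_word, vermaF_word, map_smul, LinearMap.neg_apply, LinearMap.smul_apply, wordRoot,
    List.map_cons, List.sum_cons, LinearMap.add_apply]
  module

theorem lie_vermaE_vermaF (i j : Fin n) :
    ⁅vermaE D i, vermaF j⁆ = if i = j then vermaH D (D.coroot i) else 0 := by
  rw [LieRing.of_associative_ring_bracket, vermaE_mul_vermaF]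
  exact add_sub_cancel_left (vermaF j * vermaE D i) _

/-- The difference of the two sides kills the highest weight vector and commutes with every f_i:
[e_j,f_i] is zero for i ≠ j and lies in the commutative image of 𝔥 for i = j. So `verma_eq_zero`
applies. -/
theorem lie_vermaH_vermaE (x : 𝔥) (j : Fin n) :
    ⁅vermaH D x, vermaE D j⁆ = D.root j x • vermaE D j := by
  rw [← sub_eq_zero]
  refine verma_eq_zero ?_ fun i => ?_
  · simp [LieRing.of_associative_ring_bracket, vermaE_nil, vermaH_nil]
  · rw [lie_lie_sub_smul (lie_vermaH_vermaF D x i), lie_vermaE_vermaF]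
    split_ifs with hij
    · rw [lie_vermaH_vermaH, hij]; module
    · rw [smul_zero, add_zero]
      exact lie_zero (M := Module.End ℝ (Verma n)) (vermaH D x)

theorem verma_chevalleyRelations :
    ChevalleyRelations D (vermaE D) vermaF (vermaH D) where
  h_h := lie_vermaH_vermaH D
  h_e := lie_vermaH_vermaE D
  h_f := lie_vermaH_vermaF D
  e_f i := by rw [lie_vermaE_vermaF, if_pos rfl]
  e_f_ne i j hij := by rw [lie_vermaE_vermaF, if_neg hij]

/-- A positive Serre element commutes with all f_k and kills the highest weight vector, which
generates the module under the f_k. -/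
theorem serre_vermaE (hA : IsGCM A) (hsl : A.IsSimplyLaced) {i j : Fin n} (hij : i ≠ j) :
    serre A (vermaE D) i j = 0 := by
  refine verma_eq_zero ?_ fun k => ?_
  · rcases hsl hij with h | h
    · simp [serre_of_eq_zero _ h, LieRing.of_associative_ring_bracket, vermaE_nil]
    · simp [serre_of_eq_neg_one _ h, LieRing.of_associative_ring_bracket, vermaE_nil]
  · rw [← lie_skew, (verma_chevalleyRelations D).f_serre hA hsl hij, neg_zero]

end Verma

/-- By the universal property the identity factors through the inclusion of S. -/
theorem freeLieAlgebra_mem {X : Type*} (S : LieSubalgebra ℝ (FreeLieAlgebra ℝ X))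
    (h : ∀ x, FreeLieAlgebra.of ℝ x ∈ S) (a : FreeLieAlgebra ℝ X) : a ∈ S := by
  have : S.incl.comp (FreeLieAlgebra.lift ℝ fun x => ⟨FreeLieAlgebra.of ℝ x, h x⟩) =
      LieHom.id := FreeLieAlgebra.hom_ext fun x => by simp
  rw [← LieHom.id_apply (R := ℝ) a, ← this]
  exact Subtype.property _

/-! ### Evaluation on the Verma module and the quotient carrying the action of 𝔤 -/

section BermanEval

variable {n : ℕ} {A : Matrix (Fin n) (Fin n) ℤ} {𝔥 : Type*} [AddCommGroup 𝔥] [Module ℝ 𝔥]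
  {R : Type*} [Ring R] [Algebra ℝ R] (D : CartanDatum A 𝔥) (ρ : Fin n → ℤˣ) (M : Fin n → R)

theorem sgn_mul_self (ρ : Fin n → ℤˣ) (i : Fin n) : sgn ρ i * sgn ρ i = 1 := by
  rcases Int.units_eq_one_or (ρ i) with h | h <;> simp [sgn, h]

/-- The value of `bermanEval` on a word. -/
def bermanEvalWord : List (Fin n) → R
  | [] => 1
  -- This is f_j w = ρ_j (Z_j w - e_j w); the words in e_j w are shorter than w, so the recursion
  -- terminates.
  | j :: w => sgn ρ j • (M j * bermanEvalWord w - ∑ k : Fin w.length,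
      if w[k] = j then -wordRoot D (w.drop (k + 1)) (D.coroot j) • bermanEvalWord (w.eraseIdx k)
      else 0)
termination_by w => w.length
decreasing_by
  · simp
  · have := k.2
    rw [List.length_eraseIdx_of_lt this, List.length_cons]
    omega

/-- The linear map on the Verma module that sends the highest weight vector to `1` and turns
the action of the Berman generator `e_i + ρ_i f_i` into multiplication by `M i`. -/
def bermanEval : Verma n →ₗ[ℝ] R := Finsupp.linearCombination ℝ (bermanEvalWord D ρ M)

/-- The action of the Berman generator `e_i + ρ_i f_i` on the Verma module. -/
def vermaZ (i : Fin n) : Module.End ℝ (Verma n) := vermaE D i + sgn ρ i • vermaF i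

theorem bermanEval_word (w : List (Fin n)) :
    bermanEval D ρ M (word w) = bermanEvalWord D ρ M w := by
  simp [bermanEval]

theorem bermanEval_nil : bermanEval D ρ M (word []) = 1 := by
  rw [bermanEval_word, bermanEvalWord]

theorem bermanEval_vermaF (i : Fin n) (x : Verma n) :
    bermanEval D ρ M (vermaF i x) =
      sgn ρ i • (M i * bermanEval D ρ M x - bermanEval D ρ M (vermaE D i x)) := by
  suffices h : bermanEval D ρ M ∘ₗ vermaF i = sgn ρ i • (LinearMap.mulLeft ℝ (M i) ∘ₗ
      bermanEval D ρ M - bermanEval D ρ M ∘ₗ vermaE D i) from LinearMap.congr_fun h x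
  refine verma_ext fun w => ?_
  simp only [LinearMap.comp_apply, LinearMap.smul_apply, LinearMap.sub_apply,
    LinearMap.mulLeft_apply]
  rw [vermaF_word, bermanEval_word, bermanEval_word, bermanEvalWord, vermaE,
    Finsupp.linearCombination_single, one_smul, map_sum]
  congr 2
  refine Finset.sum_congr rfl fun k _ => ?_
  rw [apply_ite (bermanEval D ρ M), map_zero, map_smul, bermanEval_word]

theorem bermanEval_vermaZ (i : Fin n) (x : Verma n) :
    bermanEval D ρ M (vermaZ D ρ i x) = M i * bermanEval D ρ M x := by
  rw [vermaZ, LinearMap.add_apply, LinearMap.smul_apply, map_add, map_smul, bermanEval_vermaF,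
    smul_smul, sgn_mul_self, one_smul, add_sub_cancel]

variable {D ρ M}

/-- The negative Serre elements map the Verma module into the kernel of `bermanEval`. -/
theorem bermanEval_serre (hA : IsGCM A) (hsl : A.IsSimplyLaced)
    (h0 : ∀ i j, A i j = 0 → ⁅M i, M j⁆ = 0)
    (h1 : ∀ i j, A i j = -1 → ⁅M i, ⁅M i, M j⁆⁆ = sgn ρ i • M j)
    {i j : Fin n} (hij : i ≠ j) (x : Verma n) :
    bermanEval D ρ M (serre A vermaF i j x) = 0 := by
  rcases hsl hij with h | h
  -- Evaluation turns [Z_i,Z_j] into left multiplication by [M_i,M_j] = 0, and on V this bracket is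
  -- ρ_i ρ_j times the negative Serre element. The other case uses the double bracket in the same
  -- way.
  · have key := (verma_chevalleyRelations D).lie_berman_of_eq_zero (sgn ρ) hij h
    rw [serre_vermaE D hA hsl hij, zero_add] at key
    have := congrArg (bermanEval D ρ M) (LinearMap.congr_fun key x)
    change bermanEval D ρ M (⁅vermaZ D ρ i, vermaZ D ρ j⁆ x) = _ at this
    rw [end_lie_apply, map_sub, LinearMap.smul_apply, map_smul] at this
    simp only [bermanEval_vermaZ] at this
    rw [← mul_assoc, ← mul_assoc, ← sub_mul, ← LieRing.of_associative_ring_bracket, h0 i j h,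
      zero_mul] at this
    exact (smul_eq_zero.1 this.symm).resolve_left (by simp [sgn])
  · have key := (verma_chevalleyRelations D).lie_lie_berman_of_eq_neg_one (sgn ρ) hij h
    rw [serre_vermaE D hA hsl hij, zero_add] at key
    have := congrArg (bermanEval D ρ M) (LinearMap.congr_fun key x)
    change bermanEval D ρ M (⁅vermaZ D ρ i, ⁅vermaZ D ρ i, vermaZ D ρ j⁆⁆ x) =
      bermanEval D ρ M (_ + sgn ρ i • vermaZ D ρ j x) at this
    simp only [end_lie_apply, map_sub, map_add, LinearMap.smul_apply, map_smul,
      bermanEval_vermaZ] at this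
    have h2 := congrArg (· * bermanEval D ρ M x) (h1 i j h)
    simp only [LieRing.of_associative_ring_bracket, mul_sub, sub_mul, smul_mul_assoc,
      mul_assoc] at h2
    rw [h2, right_eq_add] at this
    exact (smul_eq_zero.1 this).resolve_left (by simp [sgn])

variable (D ρ M)

/-- Submodules of the kernel of `bermanEval` that are stable under the action of the positive
Borel subalgebra. -/
structure IsBorelStable (U : Submodule ℝ (Verma n)) : Prop where
  le_ker : ∀ x ∈ U, bermanEval D ρ M x = 0
  vermaE_mem : ∀ i, ∀ x ∈ U, vermaE D i x ∈ U
  vermaH_mem : ∀ h, ∀ x ∈ U, vermaH D h x ∈ U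

/-- The largest submodule of the kernel of `bermanEval` stable under the positive Borel. -/
def bermanKer : Submodule ℝ (Verma n) := sSup {U | IsBorelStable D ρ M U}

variable {D ρ M}

theorem IsBorelStable.le_bermanKer {U : Submodule ℝ (Verma n)} (hU : IsBorelStable D ρ M U) :
    U ≤ bermanKer D ρ M := le_sSup hU

theorem isBorelStable_bermanKer : IsBorelStable D ρ M (bermanKer D ρ M) where
  le_ker := by
    change bermanKer D ρ M ≤ LinearMap.ker (bermanEval D ρ M)
    exact sSup_le fun U hU => hU.le_ker
  vermaE_mem i := by
    change bermanKer D ρ M ≤ (bermanKer D ρ M).comap (vermaE D i)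
    exact sSup_le fun U hU x hx => hU.le_bermanKer (hU.vermaE_mem i x hx)
  vermaH_mem h := by
    change bermanKer D ρ M ≤ (bermanKer D ρ M).comap (vermaH D h)
    exact sSup_le fun U hU x hx => hU.le_bermanKer (hU.vermaH_mem h x hx)

theorem vermaE_vermaF (i j : Fin n) (x : Verma n) : vermaE D i (vermaF j x) =
    vermaF j (vermaE D i x) + if i = j then vermaH D (D.coroot i) x else 0 := by
  have := LinearMap.congr_fun (vermaE_mul_vermaF D i j) x
  split_ifs at this ⊢ <;> simpa using this

theorem vermaH_vermaF (h : 𝔥) (j : Fin n) (x : Verma n) : vermaH D h (vermaF j x) =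
    vermaF j (vermaH D h x) - D.root j h • vermaF j x := by
  have := LinearMap.congr_fun (lie_vermaH_vermaF D h j) x
  rw [end_lie_apply, sub_eq_iff_eq_add'] at this
  rw [this]; simp [sub_eq_add_neg]

/-- By maximality it suffices that K + f_i K is Borel-stable and evaluates to zero. Stability comes
from commuting e_j and h past f_i; the value of f_i y is a combination of M_i times the value of y
and the value of e_i y, both zero. -/
theorem vermaF_mem_bermanKer (i : Fin n) {x : Verma n} (hx : x ∈ bermanKer D ρ M) :
    vermaF i x ∈ bermanKer D ρ M := by
  set K := bermanKer D ρ M with hK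
  have hs : IsBorelStable D ρ M K := isBorelStable_bermanKer
  suffices h : IsBorelStable D ρ M (K ⊔ K.map (vermaF i)) from
    h.le_bermanKer (Submodule.mem_sup_right (Submodule.mem_map_of_mem hx))
  refine ⟨?_, fun j => ?_, fun h => ?_⟩
  · change K ⊔ K.map (vermaF i) ≤ LinearMap.ker (bermanEval D ρ M)
    refine sup_le hs.le_ker (Submodule.map_le_iff_le_comap.2 fun y hy => ?_)
    simp [bermanEval_vermaF, hs.le_ker y hy, hs.le_ker _ (hs.vermaE_mem i y hy)]
  · change _ ≤ (K ⊔ K.map (vermaF i)).comap (vermaE D j)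
    refine sup_le (fun y hy => Submodule.mem_sup_left (hs.vermaE_mem j y hy))
      (Submodule.map_le_iff_le_comap.2 fun y hy => ?_)
    rw [Submodule.mem_comap, Submodule.mem_comap, vermaE_vermaF]
    refine add_mem (Submodule.mem_sup_right (Submodule.mem_map_of_mem (hs.vermaE_mem j y hy)))
      (Submodule.mem_sup_left ?_)
    split_ifs
    exacts [hs.vermaH_mem _ y hy, zero_mem _]
  · change _ ≤ (K ⊔ K.map (vermaF i)).comap (vermaH D h)
    refine sup_le (fun y hy => Submodule.mem_sup_left (hs.vermaH_mem h y hy))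
      (Submodule.map_le_iff_le_comap.2 fun y hy => ?_)
    rw [Submodule.mem_comap, Submodule.mem_comap, vermaH_vermaF]
    exact Submodule.mem_sup_right (sub_mem (Submodule.mem_map_of_mem (hs.vermaH_mem h y hy))
      (Submodule.smul_mem _ _ (Submodule.mem_map_of_mem hy)))

/-- The range of a negative Serre element is Borel-stable, since the element commutes with the e_k
and is a weight vector; maximality again applies. -/
theorem serre_mem_bermanKer (hA : IsGCM A) (hsl : A.IsSimplyLaced)
    (h0 : ∀ i j, A i j = 0 → ⁅M i, M j⁆ = 0)
    (h1 : ∀ i j, A i j = -1 → ⁅M i, ⁅M i, M j⁆⁆ = sgn ρ i • M j)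
    {i j : Fin n} (hij : i ≠ j) (x : Verma n) :
    serre A vermaF i j x ∈ bermanKer D ρ M := by
  suffices h : IsBorelStable D ρ M (LinearMap.range (serre A vermaF i j)) from
    h.le_bermanKer (LinearMap.mem_range_self _ x)
  refine ⟨?_, ?_, ?_⟩
  · rintro _ ⟨y, rfl⟩
    exact bermanEval_serre hA hsl h0 h1 hij y
  · rintro k _ ⟨y, rfl⟩
    have := LinearMap.congr_fun ((verma_chevalleyRelations D).e_serre hA hsl hij k) y
    rw [end_lie_apply, LinearMap.zero_apply, sub_eq_zero] at this
    exact ⟨_, this.symm⟩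
  · rintro h _ ⟨y, rfl⟩
    obtain ⟨c, hc⟩ := (verma_chevalleyRelations D).exists_h_serre i j h
    have := LinearMap.congr_fun hc y
    rw [end_lie_apply, LinearMap.smul_apply, sub_eq_iff_eq_add] at this
    rw [this]
    exact add_mem (Submodule.smul_mem _ _ (LinearMap.mem_range_self _ _))
      (LinearMap.mem_range_self _ _)

variable (D ρ M)

/-- The quotient of the Verma module on which the Serre relations hold. -/
abbrev VermaQuot : Type := Verma n ⧸ bermanKer D ρ M

/-- The action of the generators on the quotient. -/
def quotGen : Gen n 𝔥 → Module.End ℝ (VermaQuot D ρ M)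
  | Gen.e i => Submodule.mapQ _ _ (vermaE D i) (isBorelStable_bermanKer.vermaE_mem i)
  | Gen.f i => Submodule.mapQ _ _ (vermaF i) fun _ => vermaF_mem_bermanKer i
  | Gen.h x => Submodule.mapQ _ _ (vermaH D x) (isBorelStable_bermanKer.vermaH_mem x)

/-- The action of the generators on the Verma module. -/
def vermaGen : Gen n 𝔥 → Module.End ℝ (Verma n)
  | Gen.e i => vermaE D i
  | Gen.f i => vermaF i
  | Gen.h x => vermaH D x

theorem quotGen_mkQ (g : Gen n 𝔥) (x : Verma n) : quotGen D ρ M g ((bermanKer D ρ M).mkQ x) =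
    (bermanKer D ρ M).mkQ (vermaGen D g x) := by
  cases g <;> rfl

/-- Reduces each relation on the quotient to the claim that its relator maps V into `bermanKer`. -/
theorem lift_quotGen_mkQ (a : Free n 𝔥) (x : Verma n) :
    FreeLieAlgebra.lift ℝ (quotGen D ρ M) a ((bermanKer D ρ M).mkQ x) =
      (bermanKer D ρ M).mkQ (FreeLieAlgebra.lift ℝ (vermaGen D) a x) := by
  let S : LieSubalgebra ℝ (Free n 𝔥) :=
    { carrier := {a | ∀ x, FreeLieAlgebra.lift ℝ (quotGen D ρ M) a ((bermanKer D ρ M).mkQ x) =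
        (bermanKer D ρ M).mkQ (FreeLieAlgebra.lift ℝ (vermaGen D) a x)}
      add_mem' := fun ha hb x => by
        rw [map_add, map_add, LinearMap.add_apply, LinearMap.add_apply, ha, hb, map_add]
      zero_mem' := fun x => by simp
      smul_mem' := fun c a ha x => by
        rw [map_smul, map_smul, LinearMap.smul_apply, LinearMap.smul_apply, ha, map_smul]
      lie_mem' := fun ha hb x => by
        rw [LieHom.map_lie, LieHom.map_lie, end_lie_apply, end_lie_apply, ha, hb, hb, ha,
          map_sub] }
  have hS : a ∈ S := freeLieAlgebra_mem S (fun g x => by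
    rw [FreeLieAlgebra.lift_of_apply, FreeLieAlgebra.lift_of_apply, quotGen_mkQ]) a
  exact hS x

variable {D ρ M}

theorem lift_quotGen_relator (hA : IsGCM A) (hsl : A.IsSimplyLaced)
    (h0 : ∀ i j, A i j = 0 → ⁅M i, M j⁆ = 0)
    (h1 : ∀ i j, A i j = -1 → ⁅M i, ⁅M i, M j⁆⁆ = sgn ρ i • M j)
    (a : Free n 𝔥) (ha : IsRelator D a) : FreeLieAlgebra.lift ℝ (quotGen D ρ M) a = 0 := by
  suffices h : ∀ x, FreeLieAlgebra.lift ℝ (vermaGen D) a x ∈ bermanKer D ρ M by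
    refine LinearMap.ext fun y => ?_
    obtain ⟨x, rfl⟩ := (bermanKer D ρ M).mkQ_surjective y
    rw [lift_quotGen_mkQ]
    exact (Submodule.Quotient.mk_eq_zero _).2 (h x)
  have hV := verma_chevalleyRelations D
  have of_zero (h : FreeLieAlgebra.lift ℝ (vermaGen D) a = 0) (x : Verma n) :
      FreeLieAlgebra.lift ℝ (vermaGen D) a x ∈ bermanKer D ρ M := by
    rw [h]; exact zero_mem _
  cases ha with
  | h_add x y => exact of_zero (by simp [vermaGen, vermaH_add])
  | h_smul c x => exact of_zero (by simp [vermaGen, vermaH_smul])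
  | h_h x y => exact of_zero (by simpa [vermaGen] using hV.h_h x y)
  | h_e x j =>
    refine of_zero ?_
    simp only [map_sub, map_smul, LieHom.map_lie, FreeLieAlgebra.lift_of_apply, vermaGen]
    exact sub_eq_zero.2 (hV.h_e x j)
  | h_f x j =>
    refine of_zero ?_
    simp only [map_add, map_smul, LieHom.map_lie, FreeLieAlgebra.lift_of_apply, vermaGen]
    exact add_eq_zero_iff_eq_neg.2 (hV.h_f x j)
  | e_f i =>
    refine of_zero ?_
    simp only [map_sub, LieHom.map_lie, FreeLieAlgebra.lift_of_apply, vermaGen]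
    exact sub_eq_zero.2 (hV.e_f i)
  | e_f_ne i j hij => exact of_zero (by simpa [vermaGen] using hV.e_f_ne i j hij)
  | serre_e i j hij =>
    refine of_zero ?_
    rw [map_ad_pow]
    simp only [FreeLieAlgebra.lift_of_apply, vermaGen]
    exact serre_vermaE D hA hsl hij
  | serre_f i j hij =>
    intro x
    rw [map_ad_pow]
    simp only [FreeLieAlgebra.lift_of_apply, vermaGen]
    exact serre_mem_bermanKer hA hsl h0 h1 hij x
end BermanEval

/-! ### The Berman generators generate Fix_σ -/

section Fix

variable {n : ℕ} {A : Matrix (Fin n) (Fin n) ℤ} {𝔥 : Type*} [AddCommGroup 𝔥] [Module ℝ 𝔥]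
  {D : CartanDatum A 𝔥} {ρ : Fin n → ℤˣ}

theorem chevalleyRelations : ChevalleyRelations D (e D) (f D) (h D) where
  h_h := lie_h_h
  h_e := lie_h_e
  h_f := lie_h_f
  e_f := lie_e_f
  e_f_ne _ _ := lie_e_f_ne

theorem mem_of_generators_mem (S : LieSubalgebra ℝ (Alg D)) (he : ∀ i, e D i ∈ S)
    (hf : ∀ i, f D i ∈ S) (hh : ∀ x, h D x ∈ S) (x : Alg D) : x ∈ S := by
  obtain ⟨a, rfl⟩ : ∃ a, mk D a = x := Submodule.Quotient.mk_surjective _ x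
  refine freeLieAlgebra_mem (S.comap (mk D)) (fun g => ?_) a
  cases g with
  | e i => exact he i
  | f i => exact hf i
  | h x => exact hh x

/-- A subspace that contains the generators and is stable under their action is everything. -/
theorem mem_of_generators_stable (P : Submodule ℝ (Alg D)) (he : ∀ i, e D i ∈ P)
    (hf : ∀ i, f D i ∈ P) (hh : ∀ x, h D x ∈ P) (he' : ∀ i, ∀ x ∈ P, ⁅e D i, x⁆ ∈ P)
    (hf' : ∀ i, ∀ x ∈ P, ⁅f D i, x⁆ ∈ P) (hh' : ∀ y, ∀ x ∈ P, ⁅h D y, x⁆ ∈ P) (x : Alg D) :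
    x ∈ P := by
  let S : LieSubalgebra ℝ (Alg D) :=
    { carrier := {x | ∀ y ∈ P, ⁅x, y⁆ ∈ P}
      add_mem' := fun ha hb y hy => by rw [add_lie]; exact add_mem (ha y hy) (hb y hy)
      zero_mem' := fun y _ => by simp
      smul_mem' := fun c a ha y hy => by rw [smul_lie]; exact P.smul_mem c (ha y hy)
      lie_mem' := fun ha hb y hy => by
        rw [lie_lie]; exact sub_mem (ha _ (hb y hy)) (hb _ (ha y hy)) }
  -- The stabilizer of P is a subalgebra containing the generators, so P is an ideal.
  have hS : ∀ x, x ∈ S := mem_of_generators_mem S he' hf' hh'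
  let P' : LieSubalgebra ℝ (Alg D) := { P with lie_mem' := fun {x y} _ hy => hS x y hy }
  exact mem_of_generators_mem P' he hf hh x

theorem sigma_h (x : 𝔥) : sigma D ρ (h D x) = -h D x := by
  change eta D (tau D ρ (h D x)) = _
  have h1 : tau D ρ (h D x) = h D x := by simp [tau, h, lift_mk, tauGen]
  have h2 : eta D (h D x) = -h D x := by simp [eta, h, lift_mk, etaGen]
  rw [h1, h2]

theorem sgn_inv (ρ : Fin n → ℤˣ) (i : Fin n) : (sgn ρ i)⁻¹ = sgn ρ i :=
  inv_eq_of_mul_eq_one_left (sgn_mul_self ρ i)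

theorem sigma_sigma (x : Alg D) : sigma D ρ (sigma D ρ x) = x := by
  let S : LieSubalgebra ℝ (Alg D) :=
    { carrier := {x | sigma D ρ (sigma D ρ x) = x}
      add_mem' := fun ha hb => by simp_all
      zero_mem' := by simp
      smul_mem' := fun c a ha => by simp_all
      lie_mem' := fun ha hb => by simp_all }
  refine mem_of_generators_mem S (fun i => ?_) (fun i => ?_) (fun x => ?_) x
  · change sigma D ρ (sigma D ρ _) = _
    rw [sigma_e, map_smul, sigma_f, smul_smul, sgn_mul_inv, one_smul]
  · change sigma D ρ (sigma D ρ _) = _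
    rw [sigma_f, map_smul, sigma_e, smul_smul, sgn_inv, sgn_mul_self, one_smul]
  · change sigma D ρ (sigma D ρ _) = _
    rw [sigma_h, map_neg, sigma_h, neg_neg]

variable (D) in
/-- The image of `𝔥`. -/
def cartan : Submodule ℝ (Alg D) :=
  LinearMap.range ({ toFun := h D, map_add' := h_add, map_smul' := h_smul } : 𝔥 →ₗ[ℝ] Alg D)

theorem h_mem_cartan (x : 𝔥) : h D x ∈ cartan D := ⟨x, rfl⟩

/-- Subspaces of upper triangular elements `x` such that `x + σ x` lies in `S`. -/
structure IsUpper (ρ : Fin n → ℤˣ) (S : LieSubalgebra ℝ (Alg D)) (U : Submodule ℝ (Alg D)) :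
    Prop where
  add_sigma_mem : ∀ x ∈ U, x + sigma D ρ x ∈ S
  h_mem : ∀ y, ∀ x ∈ U, ⁅h D y, x⁆ ∈ U
  f_mem : ∀ i, ∀ x ∈ U, ⁅f D i, x⁆ ∈ U ⊔ cartan D

variable {S : LieSubalgebra ℝ (Alg D)}

/-- The elements `x` such that `x + σ x` lies in `S`. -/
def addSigmaComap (ρ : Fin n → ℤˣ) (S : LieSubalgebra ℝ (Alg D)) : Submodule ℝ (Alg D) :=
  S.toSubmodule.comap (LinearMap.id + (sigma D ρ : Alg D →ₗ[ℝ] Alg D))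

theorem mem_addSigmaComap {x : Alg D} : x ∈ addSigmaComap ρ S ↔ x + sigma D ρ x ∈ S := Iff.rfl

theorem cartan_le_addSigmaComap : cartan D ≤ addSigmaComap ρ S := by
  rintro _ ⟨x, rfl⟩
  change h D x + sigma D ρ (h D x) ∈ S
  rw [sigma_h, add_neg_cancel]
  exact zero_mem S

variable (ρ S) in
/-- The largest subspace satisfying `IsUpper`. -/
def upper : Submodule ℝ (Alg D) := sSup {U | IsUpper ρ S U}

theorem IsUpper.le_upper {U : Submodule ℝ (Alg D)} (hU : IsUpper ρ S U) : U ≤ upper ρ S :=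
  le_sSup hU

theorem isUpper_upper : IsUpper ρ S (upper ρ S) where
  add_sigma_mem := by
    change upper ρ S ≤ addSigmaComap ρ S
    exact sSup_le fun U hU => hU.add_sigma_mem
  h_mem y := by
    change upper ρ S ≤ (upper ρ S).comap (LieAlgebra.ad ℝ (Alg D) (h D y))
    exact sSup_le fun U hU x hx => hU.le_upper (hU.h_mem y x hx)
  f_mem i := by
    change upper ρ S ≤ (upper ρ S ⊔ cartan D).comap (LieAlgebra.ad ℝ (Alg D) (f D i))
    exact sSup_le fun U hU x hx => sup_le_sup_right hU.le_upper _ (hU.f_mem i x hx)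

theorem e_mem_upper (hS : ∀ i, e D i + sgn ρ i • f D i ∈ S) (i : Fin n) :
    e D i ∈ upper ρ S := by
  suffices h : IsUpper ρ S (ℝ ∙ e D i) from h.le_upper (Submodule.mem_span_singleton_self _)
  refine ⟨?_, fun y => ?_, fun j => ?_⟩
  · change (ℝ ∙ e D i) ≤ addSigmaComap ρ S
    rw [Submodule.span_singleton_le_iff_mem, mem_addSigmaComap, sigma_e]
    exact hS i
  · change (ℝ ∙ e D i) ≤ (ℝ ∙ e D i).comap (LieAlgebra.ad ℝ (Alg D) (h D y))
    rw [Submodule.span_singleton_le_iff_mem, Submodule.mem_comap, LieAlgebra.ad_apply, lie_h_e]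
    exact Submodule.smul_mem _ _ (Submodule.mem_span_singleton_self _)
  · change (ℝ ∙ e D i) ≤ ((ℝ ∙ e D i) ⊔ cartan D).comap (LieAlgebra.ad ℝ (Alg D) (f D j))
    rw [Submodule.span_singleton_le_iff_mem, Submodule.mem_comap, LieAlgebra.ad_apply]
    refine Submodule.mem_sup_right ?_
    rcases eq_or_ne j i with rfl | hij
    · rw [chevalleyRelations.f_e]
      exact neg_mem (h_mem_cartan _)
    · rw [chevalleyRelations.f_e_ne hij]
      exact zero_mem _

theorem lie_e_h_mem_upper (hS : ∀ i, e D i + sgn ρ i • f D i ∈ S) (i : Fin n) {x : Alg D}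
    (hx : x ∈ cartan D) : ⁅e D i, x⁆ ∈ upper ρ S := by
  obtain ⟨y, rfl⟩ := hx
  change ⁅e D i, h D y⁆ ∈ _
  rw [← lie_skew, lie_h_e]
  exact neg_mem (Submodule.smul_mem _ _ (e_mem_upper hS i))

/-- By maximality it suffices that K + [e_i,K] is again upper. -/
theorem lie_e_mem_upper (hS : ∀ i, e D i + sgn ρ i • f D i ∈ S) (i : Fin n) {x : Alg D}
    (hx : x ∈ upper ρ S) : ⁅e D i, x⁆ ∈ upper ρ S := by
  set K := upper ρ S with hK
  have hs : IsUpper ρ S K := isUpper_upper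
  let a := LieAlgebra.ad ℝ (Alg D) (e D i)
  have ha {y : Alg D} (hy : y ∈ K) : ⁅e D i, y⁆ ∈ K.map a := Submodule.mem_map_of_mem (f := a) hy
  suffices h : IsUpper ρ S (K ⊔ K.map a) from h.le_upper (Submodule.mem_sup_right (ha hx))
  refine ⟨?_, fun y => ?_, fun j => ?_⟩
  · change K ⊔ K.map a ≤ addSigmaComap ρ S
    refine sup_le hs.add_sigma_mem (Submodule.map_le_iff_le_comap.2 fun u hu => ?_)
    change ⁅e D i, u⁆ + sigma D ρ ⁅e D i, u⁆ ∈ S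
    have h1 := S.lie_mem (hS i) (hs.add_sigma_mem u hu)
    have h2 : ⁅f D i, u⁆ + sigma D ρ ⁅f D i, u⁆ ∈ S :=
      sup_le (a := K) hs.add_sigma_mem cartan_le_addSigmaComap (hs.f_mem i u hu)
    have h3 : sigma D ρ (e D i + sgn ρ i • f D i) = e D i + sgn ρ i • f D i :=
      (berman D ρ i).2
    -- Since σ fixes Z_i, [Z_i, u + σu] = [Z_i,u] + σ[Z_i,u]; expanding Z_i isolates the e_i part.
    -- The f_i part lies in S because [f_i,u] is in K + 𝔥 and h + σh = 0.
    have h4 : ⁅e D i, u⁆ + sigma D ρ ⁅e D i, u⁆ =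
        ⁅e D i + sgn ρ i • f D i, u + sigma D ρ u⁆ -
          sgn ρ i • (⁅f D i, u⁆ + sigma D ρ ⁅f D i, u⁆) := by
      rw [lie_add]
      nth_rw 2 [← h3]
      rw [← LieHom.map_lie, add_lie, smul_lie, map_add, map_smul]
      module
    rw [h4]
    exact sub_mem h1 (S.smul_mem _ h2)
  · change _ ≤ (K ⊔ K.map a).comap (LieAlgebra.ad ℝ (Alg D) (h D y))
    refine sup_le (fun u hu => Submodule.mem_sup_left (hs.h_mem y u hu))
      (Submodule.map_le_iff_le_comap.2 fun u hu => ?_)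
    change ⁅h D y, ⁅e D i, u⁆⁆ ∈ K ⊔ K.map a
    rw [leibniz_lie, lie_h_e, smul_lie]
    exact Submodule.mem_sup_right (add_mem (Submodule.smul_mem _ _ (ha hu))
      (ha (hs.h_mem y u hu)))
  · change _ ≤ (K ⊔ K.map a ⊔ cartan D).comap (LieAlgebra.ad ℝ (Alg D) (f D j))
    refine sup_le (fun u hu =>
      sup_le_sup_right (le_sup_left : K ≤ K ⊔ K.map a) (cartan D) (hs.f_mem j u hu))
      (Submodule.map_le_iff_le_comap.2 fun u hu => ?_)
    change ⁅f D j, ⁅e D i, u⁆⁆ ∈ K ⊔ K.map a ⊔ cartan D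
    rw [leibniz_lie]
    refine Submodule.mem_sup_left (add_mem (Submodule.mem_sup_left ?_) ?_)
    · rcases eq_or_ne j i with rfl | hij
      · rw [chevalleyRelations.f_e, neg_lie]
        exact neg_mem (hs.h_mem _ u hu)
      · rw [chevalleyRelations.f_e_ne hij, zero_lie]
        exact zero_mem _
    · obtain ⟨v, hv, w, hw, hvw⟩ := Submodule.mem_sup.1 (hs.f_mem j u hu)
      rw [← hvw, lie_add]
      exact add_mem (Submodule.mem_sup_right (ha hv))
        (Submodule.mem_sup_left (lie_e_h_mem_upper hS i hw))

/-- A subalgebra containing the Berman generators contains `x + σ x` for all `x`. -/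
theorem add_sigma_mem (hS : ∀ i, e D i + sgn ρ i • f D i ∈ S) (x : Alg D) :
    x + sigma D ρ x ∈ S := by
  set K := upper ρ S with hK
  have hs : IsUpper ρ S K := isUpper_upper
  let s : Alg D →ₗ[ℝ] Alg D := sigma D ρ
  have hKs {u : Alg D} (hu : u ∈ K) : sigma D ρ u ∈ K.map s := Submodule.mem_map_of_mem (f := s) hu
  have hCs {u : Alg D} (hu : u ∈ K ⊔ cartan D) : sigma D ρ u ∈ K.map s ⊔ cartan D := by
    obtain ⟨v, hv, _, ⟨y, rfl⟩, rfl⟩ := Submodule.mem_sup.1 hu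
    change sigma D ρ (v + h D y) ∈ _
    rw [map_add, sigma_h]
    exact Submodule.add_mem_sup (hKs hv) (neg_mem (h_mem_cartan y))
  have he (i : Fin n) : e D i = sgn ρ i • sigma D ρ (f D i) := by
    rw [sigma_f, smul_smul, sgn_mul_inv, one_smul]
  have hf (i : Fin n) : f D i = sgn ρ i • sigma D ρ (e D i) := by
    rw [sigma_e, smul_smul, sgn_mul_self, one_smul]
  -- What follows is a triangular decomposition: K, the image of 𝔥 and σK together contain the
  -- generators and are stable under them. Stability of σK follows from that of K, as σ exchanges
  -- e_i and f_i up to sign.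
  have hfm (i : Fin n) : f D i ∈ K.map s := by
    rw [hf]; exact Submodule.smul_mem _ _ (hKs (e_mem_upper hS i))
  set P := K ⊔ cartan D ⊔ K.map s with hP
  have hPT : P ≤ addSigmaComap ρ S := by
    refine sup_le (sup_le hs.add_sigma_mem cartan_le_addSigmaComap)
      (Submodule.map_le_iff_le_comap.2 fun u hu => ?_)
    change sigma D ρ u + sigma D ρ (sigma D ρ u) ∈ S
    rw [sigma_sigma, add_comm]
    exact hs.add_sigma_mem u hu
  have hl : K ≤ P := le_sup_left.trans le_sup_left
  have hm : cartan D ≤ P := le_sup_right.trans le_sup_left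
  have hr : K.map s ≤ P := le_sup_right
  refine hPT (mem_of_generators_stable _ (fun i => hl (e_mem_upper hS i)) (fun i => hr (hfm i))
    (fun y => hm (h_mem_cartan y)) (fun i => ?_) (fun i => ?_) (fun y => ?_) x)
  · change _ ≤ P.comap (LieAlgebra.ad ℝ (Alg D) (e D i))
    refine sup_le (sup_le (fun u hu => hl (lie_e_mem_upper hS i hu))
      fun u hu => hl (lie_e_h_mem_upper hS i hu)) (Submodule.map_le_iff_le_comap.2 fun u hu => ?_)
    change ⁅e D i, sigma D ρ u⁆ ∈ P
    rw [he, smul_lie, ← LieHom.map_lie]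
    exact Submodule.smul_mem _ _ ((sup_le hr hm : K.map s ⊔ cartan D ≤ P) (hCs (hs.f_mem i u hu)))
  · change _ ≤ P.comap (LieAlgebra.ad ℝ (Alg D) (f D i))
    refine sup_le (sup_le (fun u hu => (le_sup_left : K ⊔ cartan D ≤ P) (hs.f_mem i u hu)) ?_)
      (Submodule.map_le_iff_le_comap.2 fun u hu => ?_)
    · rintro _ ⟨y, rfl⟩
      change ⁅f D i, h D y⁆ ∈ P
      rw [← lie_skew, lie_h_f, neg_neg]
      exact Submodule.smul_mem _ _ (hr (hfm i))
    · change ⁅f D i, sigma D ρ u⁆ ∈ P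
      rw [hf, smul_lie, ← LieHom.map_lie]
      exact Submodule.smul_mem _ _ (hr (hKs (lie_e_mem_upper hS i hu)))
  · change _ ≤ P.comap (LieAlgebra.ad ℝ (Alg D) (h D y))
    refine sup_le (sup_le (fun u hu => hl (hs.h_mem y u hu)) ?_)
      (Submodule.map_le_iff_le_comap.2 fun u hu => ?_)
    · rintro _ ⟨z, rfl⟩
      change ⁅h D y, h D z⁆ ∈ P
      rw [lie_h_h]
      exact zero_mem _
    · change ⁅h D y, sigma D ρ u⁆ ∈ P
      rw [← neg_neg (h D y), ← sigma_h (ρ := ρ), neg_lie, ← LieHom.map_lie]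
      exact neg_mem (hr (hKs (hs.h_mem y u hu)))

/-- The Berman generators generate `Fix_σ`. -/
theorem fixSub_le (hS : ∀ i, e D i + sgn ρ i • f D i ∈ S) : fixSub D ρ ≤ S := by
  intro x hx
  have h1 := add_sigma_mem hS x
  rw [show sigma D ρ x = x from hx] at h1
  have h2 := S.smul_mem (1 / 2 : ℝ) h1
  rwa [show (1 / 2 : ℝ) • (x + x) = x by module] at h2

end Fix

/-! ### Homomorphisms out of Fix_σ -/

section Presentation

variable {n : ℕ} {A : Matrix (Fin n) (Fin n) ℤ} {𝔥 : Type*} [AddCommGroup 𝔥] [Module ℝ 𝔥]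
  {R : Type*} [Ring R] [Algebra ℝ R]

/-- Elements of an associative algebra that satisfy the Berman relations are the images of the
Berman generators under a homomorphism. -/
theorem exists_hom_of_berman_relations (hA : IsGCM A) (hsl : A.IsSimplyLaced)
    (D : CartanDatum A 𝔥) (ρ : Fin n → ℤˣ) (M : Fin n → R)
    (h0 : ∀ i j, A i j = 0 → ⁅M i, M j⁆ = 0)
    (h1 : ∀ i j, A i j = -1 → ⁅M i, ⁅M i, M j⁆⁆ = sgn ρ i • M j) :
    ∃ φ : fixSub D ρ →ₗ⁅ℝ⁆ R, ∀ i, φ (berman D ρ i) = M i := by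
  let act : Alg D →ₗ⁅ℝ⁆ Module.End ℝ (VermaQuot D ρ M) :=
    lift (quotGen D ρ M) (lift_quotGen_relator hA hsl h0 h1)
  let ev : VermaQuot D ρ M →ₗ[ℝ] R :=
    (bermanKer D ρ M).liftQ (bermanEval D ρ M) isBorelStable_bermanKer.le_ker
  let v : VermaQuot D ρ M := (bermanKer D ρ M).mkQ (word [])
  have hv : ev v = 1 := bermanEval_nil D ρ M
  -- Elements acting through ev as left multiplication by some m. Taking y = v shows m = ev(x v), so
  -- the map below is multiplicative on brackets.
  let S : LieSubalgebra ℝ (Alg D) :=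
    { carrier := {x | ∃ m, ∀ y, ev (act x y) = m * ev y}
      add_mem' := by
        rintro a b ⟨m, hm⟩ ⟨m', hm'⟩
        exact ⟨m + m', fun y => by
          rw [map_add, LinearMap.add_apply, map_add, hm, hm', add_mul]⟩
      zero_mem' := ⟨0, fun y => by simp⟩
      smul_mem' := by
        rintro c a ⟨m, hm⟩
        exact ⟨c • m, fun y => by
          rw [map_smul, LinearMap.smul_apply, map_smul, hm, smul_mul_assoc]⟩
      lie_mem' := by
        rintro a b ⟨m, hm⟩ ⟨m', hm'⟩
        exact ⟨m * m' - m' * m, fun y => by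
          rw [LieHom.map_lie, end_lie_apply, map_sub, hm, hm', hm', hm, sub_mul, mul_assoc,
            mul_assoc]⟩ }
  have hact (i : Fin n) (y : VermaQuot D ρ M) :
      ev (act (e D i + sgn ρ i • f D i) y) = M i * ev y := by
    obtain ⟨x, rfl⟩ := (bermanKer D ρ M).mkQ_surjective y
    have he : act (e D i) = quotGen D ρ M (Gen.e i) := FreeLieAlgebra.lift_of_apply _ _
    have hf : act (f D i) = quotGen D ρ M (Gen.f i) := FreeLieAlgebra.lift_of_apply _ _
    rw [map_add, map_smul, he, hf]
    exact bermanEval_vermaZ D ρ M i x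
  have hS : fixSub D ρ ≤ S := fixSub_le fun i => ⟨M i, hact i⟩
  refine ⟨{ toFun := fun x => ev (act x v)
            map_add' := fun x y => by simp
            map_smul' := fun c x => by simp
            map_lie' := ?_ }, fun i => ?_⟩
  · rintro ⟨x, hx⟩ ⟨y, hy⟩
    obtain ⟨m, hm⟩ := hS hx
    obtain ⟨m', hm'⟩ := hS hy
    change ev (act ⁅x, y⁆ v) = ⁅ev (act x v), ev (act y v)⁆
    rw [LieHom.map_lie, end_lie_apply, map_sub, LieRing.of_associative_ring_bracket]
    simp only [hm, hm', hv, mul_one]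
  · change ev (act (e D i + sgn ρ i • f D i) v) = M i
    rw [hact, hv, mul_one]

end Presentation

/-! ### Spin matrices -/

section Spin

variable {n : ℕ} {A : Matrix (Fin n) (Fin n) ℤ}

theorem lie_lie_of_anticomm {R : Type*} [Ring R] [Algebra ℂ R] {x y : R} {c : ℂ}
    (hx : x ^ 2 = (c / 4) • (1 : R)) (hxy : x * y + y * x = 0) :
    x * (x * y - y * x) - (x * y - y * x) * x = c • y := by
  have h1 : y * x = -(x * y) := eq_neg_of_add_eq_zero_right hxy
  have h2 : x * (x * y - y * x) - (x * y - y * x) * x = (4 : ℂ) • (x ^ 2 * y) := by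
    have h3 : (4 : ℂ) • (x ^ 2 * y) = 4 * (x ^ 2 * y) := by
      rw [Algebra.smul_def, map_ofNat]
    rw [h3, h1, sub_neg_eq_add, add_mul, mul_assoc x y x, h1]
    noncomm_ring
  rw [h2, hx, smul_mul_assoc, one_mul, smul_smul]
  congr 1
  ring

/-- Matrices satisfying the spin relations define a representation of `Fix_σ`. -/
theorem exists_hom_of_spinRelations (hA : IsGCM A) (hsl : A.IsSimplyLaced)
    {𝔥 : Type*} [AddCommGroup 𝔥] [Module ℝ 𝔥] (D : CartanDatum A 𝔥) (ρ : Fin n → ℤˣ) {N : ℕ}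
    {M : Fin n → Matrix (Fin N) (Fin N) ℂ} (hM : SpinRelations A ρ M) :
    ∃ φ : fixSub D ρ →ₗ⁅ℝ⁆ Matrix (Fin N) (Fin N) ℂ, ∀ i, φ (berman D ρ i) = M i := by
  refine exists_hom_of_berman_relations hA hsl D ρ M hM.comm fun i j hij => ?_
  refine (lie_lie_of_anticomm (hM.sq i) (hM.anticomm i j hij)).trans ?_
  ext a b
  simp [sgn]

/-- Flip the `i`-th bit. -/
def flipBit (i : Fin n) (b : Fin n → Bool) : Fin n → Bool := Function.update b i (!b i)

theorem flipBit_flipBit (i : Fin n) (b : Fin n → Bool) : flipBit i (flipBit i b) = b := by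
  simp [flipBit]

theorem flipBit_comm (i j : Fin n) (b : Fin n → Bool) :
    flipBit i (flipBit j b) = flipBit j (flipBit i b) := by
  rcases eq_or_ne i j with rfl | hij
  · rfl
  · simp only [flipBit, Function.update_of_ne hij, Function.update_of_ne hij.symm]
    exact Function.update_comm hij.symm _ _ _

/-- The sign by which the `i`-th spin operator differs from the flip of the `i`-th bit. -/
def spinSign (A : Matrix (Fin n) (Fin n) ℤ) (i : Fin n) (b : Fin n → Bool) : ℂ :=
  ∏ j, if j < i ∧ A i j ≠ 0 ∧ b j = true then -1 else 1

theorem spinSign_mul_self (i : Fin n) (b : Fin n → Bool) :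
    spinSign A i b * spinSign A i b = 1 := by
  rw [spinSign, ← Finset.prod_mul_distrib]
  refine Finset.prod_eq_one fun j _ => ?_
  split_ifs <;> simp

theorem spinSign_flipBit (i k : Fin n) (b : Fin n → Bool) : spinSign A i (flipBit k b) =
    (if k < i ∧ A i k ≠ 0 then -1 else 1) * spinSign A i b := by
  rw [← Finset.prod_ite_eq_of_mem Finset.univ k (fun j => if j < i ∧ A i j ≠ 0 then (-1 : ℂ) else 1)
    (Finset.mem_univ k), spinSign, spinSign, ← Finset.prod_mul_distrib]
  refine Finset.prod_congr rfl fun j _ => ?_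
  rcases eq_or_ne k j with rfl | hkj
  · by_cases h : k < i ∧ A i k ≠ 0 <;> cases hb : b k <;> simp_all [flipBit]
  · simp [flipBit, Function.update_of_ne hkj.symm, hkj]

/-- The operator that flips the `i`-th bit up to sign, multiplied by `c`. -/
def spinOp (A : Matrix (Fin n) (Fin n) ℤ) (c : ℂ) (i : Fin n) :
    Module.End ℂ ((Fin n → Bool) → ℂ) where
  toFun v b := c * spinSign A i b * v (flipBit i b)
  map_add' v w := by ext b; simp [mul_add]
  map_smul' a v := by ext b; simp; ring

theorem spinOp_mul_spinOp (c d : ℂ) (i j : Fin n) (v : (Fin n → Bool) → ℂ) (b : Fin n → Bool) :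
    (spinOp A c i * spinOp A d j) v b = (if i < j ∧ A j i ≠ 0 then -1 else 1) *
      (c * d * (spinSign A i b * spinSign A j b) * v (flipBit j (flipBit i b))) := by
  change c * spinSign A i b * (d * spinSign A j (flipBit i b) * v (flipBit j (flipBit i b))) = _
  rw [spinSign_flipBit]
  ring

/-- A Jordan–Wigner type construction: T_i flips bit i, with a sign counting the set bits j < i
adjacent to i, and is scaled by a square root of ρ_i/4. For adjacent i and j, flipping the smaller
bit changes the sign attached to the larger one and not conversely, so the two orders of composition
differ by -1; otherwise they agree. -/
theorem exists_spinRelations (hA : IsGCM A) (ρ : Fin n → ℤˣ) :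
    ∃ N : ℕ, 0 < N ∧ ∃ M : Fin n → Matrix (Fin N) (Fin N) ℂ, SpinRelations A ρ M := by
  let c (i : Fin n) : ℂ := if ρ i = 1 then 1 / 2 else Complex.I / 2
  have hc (i : Fin n) : c i * c i = ((ρ i : ℤ) : ℂ) / 4 := by
    rcases Int.units_eq_one_or (ρ i) with h | h
    · simp [c, h]; norm_num
    · simp [c, h, div_mul_div_comm]; norm_num
  let T (i : Fin n) := spinOp A (c i) i
  have hT (i : Fin n) : T i ^ 2 = (((ρ i : ℤ) : ℂ) / 4) • 1 := by
    refine LinearMap.ext fun v => funext fun b => ?_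
    rw [pow_two, spinOp_mul_spinOp, if_neg (by simp), flipBit_flipBit, spinSign_mul_self, hc]
    simp
  have h0 (i j : Fin n) (hij : A i j = 0) : T i * T j - T j * T i = 0 := by
    refine LinearMap.ext fun v => funext fun b => ?_
    rw [LinearMap.sub_apply, Pi.sub_apply, spinOp_mul_spinOp, spinOp_mul_spinOp,
      if_neg (by simp [(hA.zero_iff i j).1 hij]), if_neg (by simp [hij]), flipBit_comm]
    simp only [LinearMap.zero_apply, Pi.zero_apply]
    ring
  have h1 (i j : Fin n) (hij : A i j = -1) : T i * T j + T j * T i = 0 := by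
    have hne : i ≠ j := by
      rintro rfl
      rw [hA.diag] at hij
      omega
    have hij0 : A i j ≠ 0 := by omega
    have hji0 : A j i ≠ 0 := fun h => hij0 ((hA.zero_iff i j).2 h)
    refine LinearMap.ext fun v => funext fun b => ?_
    rw [LinearMap.add_apply, Pi.add_apply, spinOp_mul_spinOp, spinOp_mul_spinOp, flipBit_comm]
    simp only [LinearMap.zero_apply, Pi.zero_apply]
    rcases lt_or_gt_of_ne hne with h | h
    · rw [if_pos ⟨h, hji0⟩, if_neg fun h' => h.not_gt h'.1]; ring
    · rw [if_neg fun h' => h.not_gt h'.1, if_pos ⟨h, hij0⟩]; ring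
  let Φ : Module.End ℂ ((Fin n → Bool) → ℂ) ≃ₐ[ℂ] _ :=
    LinearMap.toMatrixAlgEquiv'.trans
      (Matrix.reindexAlgEquiv ℂ ℂ (Fintype.equivFin (Fin n → Bool)))
  refine ⟨_, Fintype.card_pos (α := Fin n → Bool), fun i => Φ (T i), fun i => ?_,
    fun i j hij => ?_, fun i j hij => ?_⟩
  · rw [← map_pow, hT, map_smul, map_one]
  · rw [← map_mul, ← map_mul, ← map_sub, h0 i j hij, map_zero]
  · rw [← map_mul, ← map_mul, ← map_add, h1 i j hij, map_zero]

/-- Multiplication of the matrices with `ρ_i = 1` by the imaginary unit adjusts the signs in the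
spin relations. -/
theorem SpinRelations.twist {N : ℕ} {M : Fin n → Matrix (Fin N) (Fin N) ℂ}
    (hM : SpinRelations A (fun _ => -1) M) (ρ : Fin n → ℤˣ) :
    SpinRelations A ρ fun i => if ρ i = 1 then Complex.I • M i else M i := by
  have hs (i : Fin n) : (if ρ i = 1 then Complex.I • M i else M i) =
      (if ρ i = 1 then Complex.I else 1) • M i := by
    split_ifs <;> simp
  simp only [hs]
  refine ⟨fun i => ?_, fun i j hij => ?_, fun i j hij => ?_⟩
  -- The square of the imaginary unit turns -1/4 into 1/4; the other two relations are homogeneous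
  -- in each factor, so scalars pull out.
  · rw [smul_pow, hM.sq, smul_smul]
    congr 1
    rcases Int.units_eq_one_or (ρ i) with h | h <;> simp [h]
    norm_num
  · rw [smul_mul_smul_comm, smul_mul_smul_comm, mul_comm (ite (ρ j = 1) _ _), ← smul_sub,
      hM.comm i j hij, smul_zero]
  · rw [smul_mul_smul_comm, smul_mul_smul_comm, mul_comm (ite (ρ j = 1) _ _), ← smul_add,
      hM.anticomm i j hij, smul_zero]

end Spin
end KacMoody

end

theorem mainTheorem4 {n : ℕ} (A : Matrix (Fin n) (Fin n) ℤ) (hA : IsGCM A)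
    (hsl : A.IsSimplyLaced) {𝔥 : Type*} [AddCommGroup 𝔥] [Module ℝ 𝔥] (D : CartanDatum A 𝔥)
    (ρ : Fin n → ℤˣ) :
    (∃ N : ℕ, 0 < N ∧ ∃ φ : KacMoody.fixSub D ρ →ₗ⁅ℝ⁆ Matrix (Fin N) (Fin N) ℂ,
      SpinRelations A ρ (fun i => φ (KacMoody.berman D ρ i))) ∧
    (∀ (N : ℕ) (φ₀ : KacMoody.fixSub D (fun _ => -1) →ₗ⁅ℝ⁆ Matrix (Fin N) (Fin N) ℂ),
      SpinRelations A (fun _ => -1) (fun i => φ₀ (KacMoody.berman D (fun _ => -1) i)) →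
      ∃ φ : KacMoody.fixSub D ρ →ₗ⁅ℝ⁆ Matrix (Fin N) (Fin N) ℂ,
        SpinRelations A ρ (fun i => φ (KacMoody.berman D ρ i)) ∧
        ∀ i, φ (KacMoody.berman D ρ i) =
          if ρ i = 1 then Complex.I • φ₀ (KacMoody.berman D (fun _ => -1) i)
          else φ₀ (KacMoody.berman D (fun _ => -1) i)) := by
  refine ⟨?_, fun N φ₀ h₀ => ?_⟩
  · obtain ⟨N, hN, M, hM⟩ := KacMoody.exists_spinRelations hA ρ
    obtain ⟨φ, hφ⟩ := KacMoody.exists_hom_of_spinRelations hA hsl D ρ hM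
    exact ⟨N, hN, φ, by simpa only [hφ] using hM⟩
  · have hM := KacMoody.SpinRelations.twist h₀ ρ
    obtain ⟨φ, hφ⟩ := KacMoody.exists_hom_of_spinRelations hA hsl D ρ hM
    exact ⟨φ, by simpa only [hφ] using hM, hφ⟩
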